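/- Let $k\ge 3$, let $n\ge 1$ be divisible by $3$, and write $[k]=\{1,\dots,k\}$. Let $\Delta_{k,n}$ be the set of points $x\in[0,1]^k$ with $x_1+\dots+x_k=1$ all of whose coordinates are integer multiples of $1/n$, and let $E_{k,n}$ be the set of unordered pairs $xy$ of points of $\Delta_{k,n}$ with $\|x-y\|_1=2/n$. Let $e^1,\dots,e^k$ be the vertices of the simplex and $\operatorname{supp}(x)=\{i: x_i\neq 0\}$. A $k$-way cut is a map $P:\Delta_{k,n}\to[k]$ with $P(e^i)=i$ for all $i\in[k]$; its cost with respect to edge weights $v$ on $E_{k,n}$ is $\operatorname{cost}(P,v)=\sum_{xy\in E_{k,n},\,P(x)\ne P(y)}v(x,y)$. Define weights $w$ on $E_{3,n}$ as follows, with $\rho=1/(2n)$. Let $H$ be the set of $x\in\Delta_{3,n}$ with all $x_i\le 2/3$, and let $T_i$ be the set of $x\in\Delta_{3,n}$ with $x_i\ge 2/3$. An edge with both end points in $H$ has weight $\rho$. Every other edge $xy$ has both end points in $T_i$ for exactly one $i$. If $x_j=y_j=0$ for some $j\ne i$, its weight is $\left(\tfrac n3-n(1-\max(x_i,y_i))\right)\rho$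 (so along each of the two sides of $T_i$ at $e^i$ the weights are $\tfrac n3\rho,(\tfrac n3-1)\rho,\dots,\rho$, starting from $e^i$); otherwise its weight is $0$ if $x_i=y_i$, and $\rho$ if $x_i\neq y_i$. For $a<b<c$ in $[k]$ let $\bar w_{\{a,b,c\}}(x,y)=w((x_a,x_b,x_c),(y_a,y_b,y_c))$ if $\operatorname{supp}(x),\operatorname{supp}(y)\subseteq\{a,b,c\}$, and $\bar w_{\{a,b,c\}}(x,y)=0$ otherwise. Let $\bar w=\binom k3^{-1}\sum_{a<b<c}\bar w_{\{a,b,c\}}$. For a $k$-way cut $P$ let $D_{i,j}(P)=\{P(x): x\in\Delta_{k,n},\ \operatorname{supp}(x)\subseteq\{i,j\}\}$ and $D(P)=\binom k2^{-1}\sum_{i<j}|D_{i,j}(P)|$. Then every $k$-way cut $P$ of $\Delta_{k,n}$ satisfies $$\operatorname{cost}(P,\bar w)\ \ge\ 1-\frac{D(P)-2}{k-2}.$$ -/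

import Mathlib

noncomputable section

namespace MultiwayCut

/-- The triangular grid `Δ_{k,n}`: the points of the simplex
`Δ_k = {x ∈ [0,1]^k : x_1 + ⋯ + x_k = 1}` all of whose coordinates are integer multiples
of `1/n`. -/
def grid (k n : ℕ) : Set (Fin k → ℝ) :=
  {x | x ∈ stdSimplex ℝ (Fin k) ∧ ∀ i, ∃ m : ℤ, x i = m / n}

theorem grid_finite (k n : ℕ) : (grid k n).Finite := by
  have hS : (Set.pi Set.univ fun _ : Fin k =>
      (fun m : ℤ => (m : ℝ) / n) '' (Set.Icc 0 (n : ℤ))).Finite :=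
    Set.Finite.pi fun _ => (Set.finite_Icc _ _).image _
  refine hS.subset ?_
  rintro x ⟨⟨h0, h1⟩, hx⟩ i -
  obtain ⟨m, hm⟩ := hx i
  rcases Nat.eq_zero_or_pos n with rfl | hn
  · exact ⟨0, by simp, by simp [hm]⟩
  · have hn' : (0 : ℝ) < n := by exact_mod_cast hn
    have hle : x i ≤ 1 := by
      rw [← h1]
      exact Finset.single_le_sum (fun j _ => h0 j) (Finset.mem_univ i)
    have h0i := h0 i
    rw [hm] at hle h0i
    refine ⟨m, ⟨?_, ?_⟩, hm.symm⟩
    · have : (0 : ℝ) ≤ m := by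
        by_contra! hneg
        exact absurd h0i (not_le.mpr (div_neg_of_neg_of_pos hneg hn'))
      exact_mod_cast this
    · rw [div_le_one hn'] at hle
      exact_mod_cast hle

instance (k n : ℕ) : Fintype (grid k n) := (grid_finite k n).fintype

/-- The graph `(Δ_{k,n}, E_{k,n})`: two distinct grid points are joined by an (undirected) edge
when their `ℓ¹` distance is `2/n`. -/
def gridGraph (k n : ℕ) : SimpleGraph (grid k n) where
  Adj x y := x ≠ y ∧ ∑ i, |(x : Fin k → ℝ) i - (y : Fin k → ℝ) i| = 2 / n
  symm := ⟨fun x y h => ⟨h.1.symm, by simpa only [abs_sub_comm] using h.2⟩⟩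
  loopless := ⟨fun _ h => h.1 rfl⟩

/-- A `k`-way cut of `Δ_{k,n}`: an assignment of a cluster in `[k]` to every grid point, such that
the `i`-th vertex `e^i` of the simplex is assigned to the cluster `i`. -/
def IsKWayCut {k n : ℕ} (P : grid k n → Fin k) : Prop :=
  ∀ (i : Fin k) (x : grid k n), (x : Fin k → ℝ) = Pi.single i 1 → P x = i

open scoped Classical in
/-- The cost of `P` with respect to the edge weights `w`: the total weight of the edges whose two
end points are assigned to different clusters. Every undirected edge is counted once. -/
def cost {k n : ℕ} (P : grid k n → Fin k) (w : Sym2 (grid k n) → ℝ) : ℝ :=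
  ∑ e ∈ (gridGraph k n).edgeFinset, w e * (if (e.map P).IsDiag then 0 else 1)

/-- The unit of weight `ρ = 1/(2n)`. -/
def rho (n : ℕ) : ℝ := 1 / (2 * n)

open scoped Classical in
/-- The weight of an edge `xy` of `Δ_{3,n}` that lies in the corner triangle
`T_i = {x : x_i ≥ 2/3}` (but not in the middle hexagon).
On the two sides of `T_i` containing `e^i`, the edge closest to `e^i` has weight `(n/3)ρ`, the
next one `(n/3 - 1)ρ`, and so on; here `n (1 - max x_i y_i)` is the number of edges of that
side that are closer to `e^i`. Of the other edges, those parallel to the side opposite to `e^i`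
have weight `0` and the rest have weight `ρ`. -/
def cornerWeight (n : ℕ) (i : Fin 3) (x y : Fin 3 → ℝ) : ℝ :=
  if ∃ j, j ≠ i ∧ x j = 0 ∧ y j = 0 then
    ((n : ℝ) / 3 - n * (1 - max (x i) (y i))) * rho n
  else if x i = y i then 0
  else rho n

open scoped Classical in
/-- The weight `w(x, y)` of an edge `xy` of `Δ_{3,n}`, for `n` divisible by `3`: it is `ρ` on the
middle hexagon `{x : x_i ≤ 2/3 for all i}`, border included, and every other edge lies in exactly
one of the three corner triangles. -/
def triangleWeight (n : ℕ) (x y : Fin 3 → ℝ) : ℝ :=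
  if (∀ i, x i ≤ 2 / 3) ∧ (∀ i, y i ≤ 2 / 3) then rho n
  else ∑ i, if 2 / 3 ≤ x i ∧ 2 / 3 ≤ y i then cornerWeight n i x y else 0

theorem cornerWeight_comm (n : ℕ) (i : Fin 3) (x y : Fin 3 → ℝ) :
    cornerWeight n i x y = cornerWeight n i y x := by
  unfold cornerWeight
  simp only [max_comm (x i), eq_comm (a := x i), and_comm (a := x _ = 0)]

theorem triangleWeight_comm (n : ℕ) (x y : Fin 3 → ℝ) :
    triangleWeight n x y = triangleWeight n y x := by
  unfold triangleWeight
  simp only [cornerWeight_comm n _ x y, and_comm (b := ∀ i, y i ≤ 2 / 3),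
    and_comm (b := 2 / 3 ≤ y _)]

open scoped Classical in
/-- The weights `w̄_{a,b,c}` of the triangular gap, embedded in the face of `Δ_k` spanned by
`e^a, e^b, e^c`. -/
def faceWeight {k : ℕ} (n : ℕ) (a b c : Fin k) (x y : Fin k → ℝ) : ℝ :=
  if Function.support x ⊆ {a, b, c} ∧ Function.support y ⊆ {a, b, c} then
    triangleWeight n ![x a, x b, x c] ![y a, y b, y c]
  else 0

theorem faceWeight_comm {k : ℕ} (n : ℕ) (a b c : Fin k) (x y : Fin k → ℝ) :
    faceWeight n a b c x y = faceWeight n a b c y x := by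
  unfold faceWeight
  rw [triangleWeight_comm n ![x a, x b, x c]]
  split_ifs <;> tauto

/-- The weights `w̄` on the edges of `Δ_{k,n}`: the uniform average of `w̄_{a,b,c}` over all the
three-element subsets `{a < b < c}` of `[k]`. -/
def avgWeight (k n : ℕ) : Sym2 (grid k n) → ℝ :=
  Sym2.lift ⟨fun x y =>
    (∑ t : Fin k × Fin k × Fin k with t.1 < t.2.1 ∧ t.2.1 < t.2.2,
      faceWeight n t.1 t.2.1 t.2.2 x y) / (k.choose 3 : ℝ),
    fun x y => by simp only [faceWeight_comm n _ _ _ (x : Fin k → ℝ)]⟩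

/-- `D_{i,j}(P)`: the set of the clusters to which the points on the line between `e^i` and `e^j`
(inclusive) are assigned. -/
def lineClusters {k n : ℕ} (P : grid k n → Fin k) (i j : Fin k) : Set (Fin k) :=
  {c | ∃ x : grid k n, Function.support (x : Fin k → ℝ) ⊆ {i, j} ∧ P x = c}

/-- `D(P)`: the average of `|D_{i,j}(P)|` over all the two-element subsets `{i < j}` of `[k]`. -/
def avgClusters {k n : ℕ} (P : grid k n → Fin k) : ℝ :=
  (∑ p : Fin k × Fin k with p.1 < p.2, ((lineClusters P p.1 p.2).ncard : ℝ)) /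
    (k.choose 2 : ℝ)

end MultiwayCut

end

/-! Write `n = 3m`. On one triangular face with terminal labels `v 0, v 1, v 2`, it is enough that
the cut weighs at least `1 - |O|/3`, where `O` is the set of vertices whose label also occurs on the
opposite side.

The edges of the face are partitioned among the upward triangles `{x + e₀, x + e₁, x + e₂}` with `x
∈ tri (3m-1)`; the points `z ∈ tri (3m-2)` index the downward triangles. Suppose that every corner
triangle, up to the hexagon, carries the label of its vertex. Monochromatic upward triangles are
then matched injectively to downward ones, except at most `m` of them for each `i ∈ O`
(`card_mono_le`). There are `3m` more upward triangles than downward ones, so at least `3m - m|O|`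
upward triangles are not monochromatic. Each of these has two cut edges, and `ρ = 1/(6m)` turns `6m
- 2m|O|` cut edges into `1 - |O|/3` (`six_mul_le_sum_neq`).

For a general cut, relabelling the corners in this way costs nothing: the corner weights decompose
into paths from `e^i`, one for each edge joining the relabelled region to the hexagon, and a path
whose ends differ is cut (`sum_neq_corner`, `sum_neq_le_sum_edgeWeight`).

Finally the face bounds are averaged over all triples. A label `l ∉ {i, j}` on the line `ij` is
counted exactly in the face `{i, j, l}`, so the total loss is a third of the sum of `|D_{i,j}| - 2`,
and `3 * k.choose 3 = (k - 2) * k.choose 2`. -/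

namespace MultiwayCut

/-! ### Lattice points of a triangle and its upward unit triangles. -/

/-- The lattice points `x ∈ ℕ³` with `x₀ + x₁ + x₂ = M`. -/
abbrev tri (M : ℕ) : Finset (Fin 3 → ℕ) := Finset.Nat.antidiagonalTuple 3 M

/-- The lattice point `x + eᵢ`. -/
def step (x : Fin 3 → ℕ) (i : Fin 3) : Fin 3 → ℕ := Function.update x i (x i + 1)

@[simp] theorem step_same (x : Fin 3 → ℕ) (i : Fin 3) : step x i i = x i + 1 := by
  simp [step]

theorem step_of_ne (x : Fin 3 → ℕ) {i j : Fin 3} (h : j ≠ i) : step x i j = x j := by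
  simp [step, h]

theorem step_apply (x : Fin 3 → ℕ) (i j : Fin 3) :
    step x i j = x j + if j = i then 1 else 0 := by
  by_cases h : j = i
  · subst h; simp
  · simp [step_of_ne x h, h]

theorem step_comm (x : Fin 3 → ℕ) (i j : Fin 3) : step (step x i) j = step (step x j) i := by
  funext l
  simp only [step_apply]
  omega

theorem sum_eq_cyclic {A : Type*} [AddCommMonoid A] (x : Fin 3 → A) (i : Fin 3) :
    ∑ j, x j = x i + x (i + 1) + x (i + 2) := by
  rw [Fin.sum_univ_three]
  fin_cases i
  · rfl
  · change x 0 + x 1 + x 2 = x 1 + x 2 + x 0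
    abel
  · change x 0 + x 1 + x 2 = x 2 + x 0 + x 1
    abel

theorem mem_tri_cyclic {x : Fin 3 → ℕ} {M : ℕ} (i : Fin 3) :
    x ∈ tri M ↔ x i + x (i + 1) + x (i + 2) = M := by
  rw [Finset.Nat.mem_antidiagonalTuple, sum_eq_cyclic x i]

theorem step_mem_tri {x : Fin 3 → ℕ} {M : ℕ} (hx : x ∈ tri M) (i : Fin 3) :
    step x i ∈ tri (M + 1) := by
  rw [mem_tri_cyclic i] at hx ⊢
  rw [step_same, step_of_ne x (show i + 1 ≠ i by fin_cases i <;> decide),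
    step_of_ne x (show i + 2 ≠ i by fin_cases i <;> decide)]
  omega

theorem ext_cyclic {x y : Fin 3 → ℕ} (i : Fin 3) (h0 : x i = y i) (h1 : x (i + 1) = y (i + 1))
    (h2 : x (i + 2) = y (i + 2)) : x = y := by
  funext j
  fin_cases i <;> fin_cases j <;> first | exact h0 | exact h1 | exact h2

theorem exists_step {x : Fin 3 → ℕ} {M : ℕ} (hx : x ∈ tri (M + 1)) {i : Fin 3} (hi : 0 < x i) :
    ∃ z ∈ tri M, step z i = x := by
  have h : step (Function.update x i (x i - 1)) i = x := by
    funext j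
    by_cases hj : j = i
    · subst hj; simp; omega
    · simp [step_of_ne _ hj, hj]
  refine ⟨_, ?_, h⟩
  rw [mem_tri_cyclic i] at hx ⊢
  have h1 : i + 1 ≠ i := by fin_cases i <;> decide
  have h2 : i + 2 ≠ i := by fin_cases i <;> decide
  simp [h1, h2]
  omega

/-- For `M = 3m - 2` this is the surplus `3m` of upward over downward triangles, the source of the
main constant. The points with `x 0 > 0` are shifts of `tri M`; the others form one side. -/
theorem card_tri_succ (M : ℕ) : (tri (M + 1)).card = (tri M).card + (M + 2) := by
  rw [← Finset.card_filter_add_card_filter_not (s := tri (M + 1)) (fun x => 0 < x 0)]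
  congr 1
  · refine (Finset.card_bij (fun x _ => step x 0) (fun x hx => ?_) (fun x _ y _ h => ?_)
      fun x hx => ?_).symm
    · simp only [Finset.mem_filter]
      exact ⟨step_mem_tri hx 0, by simp⟩
    · funext j
      have := congrFun h j
      simp only [step_apply] at this
      omega
    · obtain ⟨hx, h0⟩ := Finset.mem_filter.1 hx
      obtain ⟨z, hz, h⟩ := exists_step hx h0
      exact ⟨z, hz, h⟩
  · rw [← Finset.card_range (M + 2)]
    refine Finset.card_bij (fun x _ => x 1) (fun x hx => ?_) (fun x hx y hy h => ?_) fun a ha => ?_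
    · simp only [Finset.mem_filter, mem_tri_cyclic 0] at hx
      simp at hx ⊢
      omega
    · simp only [Finset.mem_filter, mem_tri_cyclic 0] at hx hy
      simp at hx hy h
      exact ext_cyclic 0 (by omega) h (show x 2 = y 2 by omega)
    · refine ⟨![0, a, M + 1 - a], ?_, rfl⟩
      simp only [Finset.mem_filter, mem_tri_cyclic 0]
      simp at ha ⊢
      omega

/-! ### Counting monochromatic upward triangles. -/

section Mono

variable {L : Type*}

/-- The three corners `x + e₀, x + e₁, x + e₂` have the same label. -/
def IsMono (Q : (Fin 3 → ℕ) → L) (x : Fin 3 → ℕ) : Prop :=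
  ∀ i, Q (step x i) = Q (step x 0)

theorem IsMono.eq {Q : (Fin 3 → ℕ) → L} {x : Fin 3 → ℕ} (h : IsMono Q x) (i j : Fin 3) :
    Q (step x i) = Q (step x j) := (h i).trans (h j).symm

variable [DecidableEq L]

instance (Q : (Fin 3 → ℕ) → L) : DecidablePred (IsMono Q) := fun _ => by
  unfold IsMono; infer_instance

/-- A monochromatic `x` labelled `v i` is sent to the downward triangle `x - eᵢ`. If its label is no
`v j`, the direction `i` is chosen by comparing the coordinates with `m`. The only obstruction is a
triangle labelled `v i` with `x i = 0`, which forces `i ∈ O`. -/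
theorem card_mono_le {m : ℕ} (hm : 0 < m) (Q : (Fin 3 → ℕ) → L) (v : Fin 3 → L)
    (hv : Function.Injective v)
    (hQ : ∀ y ∈ tri (3 * m), ∀ i, 2 * m < y i → Q y = v i) (O : Finset (Fin 3))
    (hO : ∀ y ∈ tri (3 * m), ∀ i, y i = 0 → Q y = v i → i ∈ O) :
    ((tri (3 * m - 1)).filter (IsMono Q)).card ≤ (tri (3 * m - 2)).card + m * O.card := by
  have e1 : 3 * m - 1 + 1 = 3 * m := by omega
  have e2 : 3 * m - 2 + 1 = 3 * m - 1 := by omega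
  have hlt : ∀ x ∈ tri (3 * m - 1), IsMono Q x → ∀ i j, i ≠ j → Q (step x i) = v j →
      x i < 2 * m := by
    intro x hx _ i j hij h
    by_contra! hc
    have := hQ (step x i) (e1 ▸ step_mem_tri hx i) i (by simp; omega)
    exact hij (hv (this.symm.trans h))
  -- The triangles from which `eᵢ` cannot be subtracted.
  set B : Fin 3 → Finset (Fin 3 → ℕ) := fun i =>
    (tri (3 * m - 1)).filter fun x => IsMono Q x ∧ x i = 0 ∧ Q (step x 0) = v i with hB
  have hBc : ∀ i, (B i).card ≤ m := by
    intro i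
    have h1 : i + 1 ≠ i := by fin_cases i <;> decide
    have h2 : i + 2 ≠ i := by fin_cases i <;> decide
    have key : ∀ x ∈ B i, x i = 0 ∧ x i + x (i + 1) + x (i + 2) = 3 * m - 1 ∧
        x (i + 1) < 2 * m ∧ x (i + 2) < 2 * m := by
      intro x hx
      obtain ⟨hx, hmono, h0, hq⟩ := Finset.mem_filter.1 hx
      exact ⟨h0, (mem_tri_cyclic i).1 hx, hlt x hx hmono _ i h1 ((hmono _).trans hq),
        hlt x hx hmono _ i h2 ((hmono _).trans hq)⟩
    -- The other two coordinates sum to `3m - 1` and are both below `2m`, so `x (i + 1)` lies in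
    -- `[m, 2m)` and determines `x`.
    calc (B i).card ≤ (Finset.Ico m (2 * m)).card := by
          refine Finset.card_le_card_of_injOn (fun x => x (i + 1)) (fun x hx => ?_)
            fun x hx y hy h => ?_
          · have := key x hx
            simp
            omega
          · have := key x hx
            have := key y hy
            simp only at h
            exact ext_cyclic i (by omega) h (by omega)
      _ = m := by simp; omega
  have hsub : ((tri (3 * m - 1)).filter (IsMono Q)) ⊆
      ((tri (3 * m - 1)).filter fun x => IsMono Q x ∧ ∀ i, Q (step x 0) = v i → 0 < x i) ∪
        O.biUnion B := by
    intro x hx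
    obtain ⟨hx, hmono⟩ := Finset.mem_filter.1 hx
    simp only [Finset.mem_union, Finset.mem_filter, Finset.mem_biUnion, hB]
    by_cases h : ∀ i, Q (step x 0) = v i → 0 < x i
    · exact Or.inl ⟨hx, hmono, h⟩
    · push Not at h
      obtain ⟨i, hi, h0⟩ := h
      have h0 : x i = 0 := by omega
      refine Or.inr ⟨i, ?_, hx, hmono, h0, hi⟩
      have h1 : i ≠ i + 1 := by fin_cases i <;> decide
      exact hO (step x (i + 1)) (e1 ▸ step_mem_tri hx _) i (by rw [step_of_ne x h1, h0])
        ((hmono _).trans hi)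
  refine (Finset.card_le_card hsub).trans ((Finset.card_union_le _ _).trans ?_)
  refine Nat.add_le_add ?_ ?_
  -- The matching as a relation. The clause for foreign labels is stated in terms of `z` alone,
  -- through coordinates that subtracting `eᵢ` leaves unchanged.
  · refine Finset.card_le_card_of_forall_subsingleton
      (fun x z => ∃ i, step z i = x ∧ (Q (step x 0) = v i ∨
        (∀ j, Q (step x 0) ≠ v j) ∧ m ≤ z (i + 1) ∧ z (i + 2) < m)) (fun x hx => ?_)
      fun z hz x hx y hy => ?_
    · obtain ⟨hx, hmono, hpos⟩ := Finset.mem_filter.1 hx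
      by_cases h : ∃ i, Q (step x 0) = v i
      · obtain ⟨i, hi⟩ := h
        obtain ⟨z, hz, h⟩ := exists_step (e2.symm ▸ hx) (hpos i hi)
        exact ⟨z, hz, i, h, Or.inl hi⟩
      · push Not at h
        have hs : ∀ i, x i < 2 * m := by
          intro i
          by_contra! hc
          refine h i ?_
          rw [← hmono i]
          exact hQ _ (e1 ▸ step_mem_tri hx i) i (by simp; omega)
        -- Coordinates with sum `3m - 1` are neither all at least `m` nor all below `m`, so in
        -- cyclic order some entry at least `m` is followed by one below `m`.
        have hi : ∃ i : Fin 3, m ≤ x (i + 1) ∧ x (i + 2) < m := by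
          have hx' := (mem_tri_cyclic 0).1 hx
          by_contra! hc
          have c0 := hc 0
          have c1 := hc 1
          have c2 := hc 2
          simp at c0 c1 c2 hx'
          change m ≤ x 2 → m ≤ x 0 at c1
          change m ≤ x 0 → m ≤ x 1 at c2
          omega
        obtain ⟨i, hi1, hi2⟩ := hi
        have hx' := (mem_tri_cyclic i).1 hx
        have := hs (i + 1)
        obtain ⟨z, hz, hzx⟩ := exists_step (i := i) (e2.symm ▸ hx) (by omega)
        have h1 : i + 1 ≠ i := by fin_cases i <;> decide
        have h2 : i + 2 ≠ i := by fin_cases i <;> decide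
        refine ⟨z, hz, i, hzx, Or.inr ⟨h, ?_, ?_⟩⟩
        · rwa [← hzx, step_of_ne z h1] at hi1
        · rwa [← hzx, step_of_ne z h2] at hi2
    · obtain ⟨hx, i, rfl, hi⟩ := hx
      obtain ⟨hy, j, rfl, hj⟩ := hy
      have hx := (Finset.mem_filter.1 hx).2.1
      have hy := (Finset.mem_filter.1 hy).2.1
      -- The upward triangles `z + eᵢ` and `z + eⱼ` share the point `z + eᵢ + eⱼ`.
      have hq : Q (step (step z i) 0) = Q (step (step z j) 0) := by
        rw [hx.eq 0 j, hy.eq 0 i, step_comm]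
      suffices i = j by rw [this]
      rcases hi with hi | ⟨hi, hi1, hi2⟩ <;> rcases hj with hj | ⟨hj, hj1, hj2⟩
      · exact hv (hi.symm.trans (hq.trans hj))
      · exact absurd (hq.symm.trans hi) (hj i)
      · exact absurd (hq.trans hj) (hi j)
      -- A cyclic sequence of three entries has at most one descent across the threshold `m`.
      · clear hq hx hy hi hj
        revert hi1 hi2 hj1 hj2
        fin_cases i <;> fin_cases j <;> intro hi1 hi2 hj1 hj2 <;> first | rfl | (exfalso; simp at hi1 hi2 hj1 hj2; omega)
  · refine (Finset.card_biUnion_le).trans ?_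
    rw [mul_comm]
    exact Finset.sum_le_card_nsmul _ _ _ fun i _ => hBc i

/-- The indicator of two labels being different. -/
def neq (a b : L) : ℕ := if a = b then 0 else 1

theorem neq_comm (a b : L) : neq a b = neq b a := by simp [neq, eq_comm]

theorem neq_triangle (a b c : L) : neq a c ≤ neq a b + neq b c := by
  unfold neq
  split_ifs <;> simp_all

theorem two_mul_card_le_sum_neq (S : Finset (Fin 3 → ℕ)) (Q : (Fin 3 → ℕ) → L) :
    2 * (S.filter fun x => ¬ IsMono Q x).card ≤
      ∑ x ∈ S, ∑ l : Fin 3, neq (Q (step x (l + 1))) (Q (step x (l + 2))) := by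
  rw [Finset.card_filter, Finset.mul_sum]
  refine Finset.sum_le_sum fun x _ => ?_
  rw [Fin.sum_univ_three]
  change _ ≤ neq (Q (step x 1)) (Q (step x 2)) + neq (Q (step x 2)) (Q (step x 0)) +
    neq (Q (step x 0)) (Q (step x 1))
  split_ifs with h
  · simp
  · have h' : ¬ (Q (step x 1) = Q (step x 0) ∧ Q (step x 2) = Q (step x 0)) := fun h' =>
      h fun i => by fin_cases i <;> first | rfl | exact h'.1 | exact h'.2
    unfold neq
    generalize Q (step x 0) = a at h' ⊢
    generalize Q (step x 1) = b at h' ⊢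
    generalize Q (step x 2) = c at h' ⊢
    split_ifs with h1 h2 h3 <;> first | omega | (subst_vars; simp at h')

/-- Three labels that are not all equal differ in at least two of the three pairs, so the count of
non-monochromatic triangles doubles. -/
theorem six_mul_le_sum_neq {m : ℕ} (hm : 0 < m) (Q : (Fin 3 → ℕ) → L) (v : Fin 3 → L)
    (hv : Function.Injective v)
    (hQ : ∀ y ∈ tri (3 * m), ∀ i, 2 * m < y i → Q y = v i) (O : Finset (Fin 3))
    (hO : ∀ y ∈ tri (3 * m), ∀ i, y i = 0 → Q y = v i → i ∈ O) :
    6 * m ≤ (∑ x ∈ tri (3 * m - 1), ∑ l : Fin 3,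
      neq (Q (step x (l + 1))) (Q (step x (l + 2)))) + 2 * m * O.card := by
  have h1 := card_mono_le hm Q v hv hQ O hO
  have h2 := two_mul_card_le_sum_neq (tri (3 * m - 1)) Q
  have h3 := Finset.card_filter_add_card_filter_not (s := tri (3 * m - 1)) (IsMono Q)
  have h4 := card_tri_succ (3 * m - 2)
  rw [show 3 * m - 2 + 1 = 3 * m - 1 by omega] at h4
  rw [mul_assoc]
  omega

end Mono
-- Relabelling the corner triangles by means of weighted paths.
section Corner

variable {L : Type*} [DecidableEq L]

theorem neq_le_sum_range (f : ℕ → L) (m : ℕ) :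
    neq (f 0) (f m) ≤ ∑ s ∈ Finset.range m, neq (f s) (f (s + 1)) := by
  induction m with
  | zero => simp [neq]
  | succ m ih =>
    rw [Finset.sum_range_succ]
    exact (neq_triangle _ (f m) _).trans (Nat.add_le_add_right ih _)

theorem sum_range_sum_range_succ (f : ℕ → ℕ) (m : ℕ) :
    ∑ a ∈ Finset.range m, ∑ s ∈ Finset.range (a + 1), f s =
      ∑ a ∈ Finset.range m, (m - a) * f a := by
  induction m with
  | zero => simp
  | succ m ih =>
    have h : ∀ a ∈ Finset.range m, (m + 1 - a) * f a = (m - a) * f a + f a := by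
      intro a ha
      rw [show m + 1 - a = (m - a) + 1 by simp at ha; omega]
      ring
    rw [Finset.sum_range_succ, ih, Finset.sum_range_succ, Finset.sum_range_succ,
      Finset.sum_congr rfl h, Finset.sum_add_distrib]
    simp
    ring

theorem sum_triangle_swap (g : ℕ → ℕ → ℕ) (m : ℕ) :
    ∑ a ∈ Finset.range m, ∑ b ∈ Finset.range (m - a), g a b =
      ∑ b ∈ Finset.range m, ∑ a ∈ Finset.range (m - b), g a b := by
  refine Finset.sum_comm' fun a b => ?_
  simp only [Finset.mem_range]
  omega

/-- The paths that follow the side of a corner triangle for some steps and then turn. -/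
theorem sum_neq_turning_paths (F : ℕ → ℕ → L) (m : ℕ) :
    ∑ a ∈ Finset.range m, neq (F 0 0) (F (a + 1) (m - 1 - a)) ≤
      ∑ a ∈ Finset.range m, ∑ b ∈ Finset.range (m - a),
        ((if b = 0 then (m - a) * neq (F a b) (F (a + 1) b) else 0) +
          if a = 0 then 0 else neq (F a b) (F a (b + 1))) := by
  simp only [Finset.sum_add_distrib]
  -- Path `a` runs along the side to `(a + 1, 0)`, so the side edge starting at `(s, 0)` is used by
  -- the `m - s` paths with `a ≥ s`: exactly its weight.
  have h1 : ∑ a ∈ Finset.range m, ∑ b ∈ Finset.range (m - a),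
      (if b = 0 then (m - a) * neq (F a b) (F (a + 1) b) else 0) =
      ∑ a ∈ Finset.range m, ∑ s ∈ Finset.range (a + 1), neq (F s 0) (F (s + 1) 0) := by
    rw [sum_range_sum_range_succ]
    refine Finset.sum_congr rfl fun a ha => ?_
    rw [Finset.mem_range] at ha
    rw [Finset.sum_ite_eq' (Finset.range (m - a)) 0 fun b => (m - a) * neq (F a b) (F (a + 1) b),
      if_pos (by simpa using ha)]
  -- After turning, each path has the column `a + 1` to itself. Column `0` is the other side of the
  -- corner and is left to the mirrored family.
  have h2 : ∑ a ∈ Finset.range m, ∑ b ∈ Finset.range (m - a),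
      (if a = 0 then 0 else neq (F a b) (F a (b + 1))) =
      ∑ a ∈ Finset.range m, ∑ u ∈ Finset.range (m - 1 - a),
        neq (F (a + 1) u) (F (a + 1) (u + 1)) := by
    cases m with
    | zero => simp
    | succ m =>
      rw [Finset.sum_range_succ', Finset.sum_range_succ]
      simp
  rw [h1, h2, ← Finset.sum_add_distrib]
  refine Finset.sum_le_sum fun a _ => ?_
  exact (neq_triangle _ (F (a + 1) 0) _).trans (Nat.add_le_add
    (neq_le_sum_range (fun s => F s 0) (a + 1)) (neq_le_sum_range (F (a + 1)) _))

/-- The turning paths and their mirror images use disjoint sets of edges, and together exhaust the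
weights of the two directions leaving `e^i`. -/
theorem sum_neq_corner (F : ℕ → ℕ → L) (m : ℕ) :
    ∑ a ∈ Finset.range m, (neq (F 0 0) (F (a + 1) (m - 1 - a)) +
        neq (F 0 0) (F a (m - 1 - a + 1))) ≤
      ∑ a ∈ Finset.range m, ∑ b ∈ Finset.range (m - a),
        ((if b = 0 then m - a else 1) * neq (F a b) (F (a + 1) b) +
          (if a = 0 then m - b else 1) * neq (F a b) (F a (b + 1))) := by
  have h1 := sum_neq_turning_paths F m
  have h2 := sum_neq_turning_paths (fun a b => F b a) m
  rw [sum_triangle_swap, ← Finset.sum_range_reflect] at h2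
  rw [Finset.sum_add_distrib]
  have h3 : ∑ a ∈ Finset.range m, neq (F 0 0) (F (m - 1 - (m - 1 - a)) (m - 1 - a + 1)) =
      ∑ a ∈ Finset.range m, neq (F 0 0) (F a (m - 1 - a + 1)) := by
    refine Finset.sum_congr rfl fun a ha => ?_
    rw [Finset.mem_range] at ha
    rw [show m - 1 - (m - 1 - a) = a by omega]
  rw [h3] at h2
  refine (Nat.add_le_add h1 h2).trans (le_of_eq ?_)
  rw [← Finset.sum_add_distrib]
  refine Finset.sum_congr rfl fun a _ => ?_
  rw [← Finset.sum_add_distrib]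
  refine Finset.sum_congr rfl fun b _ => ?_
  split_ifs <;> ring

/-- The point of the triangle with coordinates `a` and `b` in the two directions after `i`. -/
def cornerPoint (N : ℕ) (i : Fin 3) (a b : ℕ) : Fin 3 → ℕ :=
  fun j => if j = i then N - a - b else if j = i + 1 then a else b

theorem add_one_ne_self (i : Fin 3) : i + 1 ≠ i := by fin_cases i <;> decide
theorem add_two_ne_self (i : Fin 3) : i + 2 ≠ i := by fin_cases i <;> decide
theorem add_two_ne_add_one (i : Fin 3) : i + 2 ≠ i + 1 := by fin_cases i <;> decide
theorem add_one_add_one (i : Fin 3) : i + 1 + 1 = i + 2 := by fin_cases i <;> rfl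
theorem add_one_add_two (i : Fin 3) : i + 1 + 2 = i := by fin_cases i <;> rfl
theorem add_two_add_one (i : Fin 3) : i + 2 + 1 = i := by fin_cases i <;> rfl
theorem add_two_add_two (i : Fin 3) : i + 2 + 2 = i + 1 := by fin_cases i <;> rfl

@[simp] theorem cornerPoint_self (N : ℕ) (i : Fin 3) (a b : ℕ) :
    cornerPoint N i a b i = N - a - b := by simp [cornerPoint]

@[simp] theorem cornerPoint_one (N : ℕ) (i : Fin 3) (a b : ℕ) :
    cornerPoint N i a b (i + 1) = a := by simp [cornerPoint]

@[simp] theorem cornerPoint_two (N : ℕ) (i : Fin 3) (a b : ℕ) :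
    cornerPoint N i a b (i + 2) = b := by
  simp [cornerPoint]

theorem eq_cornerPoint {N : ℕ} {x : Fin 3 → ℕ} (hx : x ∈ tri N) (i : Fin 3) :
    x = cornerPoint N i (x (i + 1)) (x (i + 2)) := by
  rw [mem_tri_cyclic i] at hx
  refine ext_cyclic i ?_ ?_ ?_ <;> simp
  omega

theorem sum_filter_corner {m : ℕ} (hm : 0 < m) (i : Fin 3) (g : (Fin 3 → ℕ) → ℕ) (G : ℕ → ℕ → ℕ)
    (h : ∀ x ∈ tri (3 * m - 1), 2 * m ≤ x i → g x = G (x (i + 1)) (x (i + 2))) :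
    ∑ x ∈ (tri (3 * m - 1)).filter (fun x => 2 * m ≤ x i), g x =
      ∑ a ∈ Finset.range m, ∑ b ∈ Finset.range (m - a), G a b := by
  rw [Finset.sum_sigma']
  refine Finset.sum_bij' (fun x _ => ⟨x (i + 1), x (i + 2)⟩)
    (fun p _ => cornerPoint (3 * m - 1) i p.1 p.2) (fun x hx => ?_) (fun p hp => ?_)
    (fun x hx => ?_) (fun p hp => ?_) fun x hx => ?_
  · rw [Finset.mem_filter, mem_tri_cyclic i] at hx
    simp only [Finset.mem_sigma, Finset.mem_range]
    omega
  · simp only [Finset.mem_sigma, Finset.mem_range] at hp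
    rw [Finset.mem_filter, mem_tri_cyclic i]
    simp only [cornerPoint_self, cornerPoint_one, cornerPoint_two]
    omega
  · exact (eq_cornerPoint (Finset.mem_filter.1 hx).1 i).symm
  · simp
  · exact h x (Finset.mem_filter.1 hx).1 (Finset.mem_filter.1 hx).2

/-- The weight, in units of `ρ`, of the edge between `x + e_{l+1}` and `x + e_{l+2}`. -/
def edgeWeight (m : ℕ) (x : Fin 3 → ℕ) (l : Fin 3) : ℕ :=
  -- The inequality is strict: for `x l = 2 * m` the edge lies on the border of the hexagon and has
  -- weight `1`.
  if 2 * m < x l then 0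
  else if 2 * m ≤ x (l + 1) then (if x l = 0 then m - x (l + 2) else 1)
  else if 2 * m ≤ x (l + 2) then (if x l = 0 then m - x (l + 1) else 1)
  else 1

theorem sum_eq_sum_filter_add_sum_corner {m : ℕ} (hm : 0 < m) (f : (Fin 3 → ℕ) → ℕ) :
    ∑ x ∈ tri (3 * m - 1), f x =
      ∑ x ∈ (tri (3 * m - 1)).filter (fun x => ∀ i, x i < 2 * m), f x +
      ∑ i, ∑ x ∈ (tri (3 * m - 1)).filter (fun x => 2 * m ≤ x i), f x := by
  simp only [Finset.sum_filter]
  rw [Finset.sum_comm, ← Finset.sum_add_distrib]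
  refine Finset.sum_congr rfl fun x hx => ?_
  have hx := (mem_tri_cyclic 0).1 hx
  change x 0 + x 1 + x 2 = _ at hx
  have h : (∀ i, x i < 2 * m) ↔ x 0 < 2 * m ∧ x 1 < 2 * m ∧ x 2 < 2 * m := by
    simp [Fin.forall_fin_succ]
  simp only [Fin.sum_univ_three, h]
  split_ifs <;> omega

/-- The total weight of a cut is at least the number of the edges cut after relabelling all the
points with `x i > 2 m` by the label of the `i`-th vertex. -/
theorem sum_neq_le_sum_edgeWeight {m : ℕ} (hm : 0 < m) (Q Q' : (Fin 3 → ℕ) → L) (v : Fin 3 → L)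
    (hQ : ∀ i, Q (cornerPoint (3 * m) i 0 0) = v i)
    (h1 : ∀ y ∈ tri (3 * m), ∀ i, 2 * m < y i → Q' y = v i)
    (h2 : ∀ y, (∀ i, y i ≤ 2 * m) → Q' y = Q y) :
    ∑ x ∈ tri (3 * m - 1), ∑ l : Fin 3, neq (Q' (step x (l + 1))) (Q' (step x (l + 2))) ≤
      ∑ x ∈ tri (3 * m - 1), ∑ l : Fin 3,
        edgeWeight m x l * neq (Q (step x (l + 1))) (Q (step x (l + 2))) := by
  have e1 : 3 * m - 1 + 1 = 3 * m := by omega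
  rw [sum_eq_sum_filter_add_sum_corner hm, sum_eq_sum_filter_add_sum_corner hm]
  refine Nat.add_le_add (Finset.sum_le_sum fun x hx => Finset.sum_le_sum fun l _ => ?_)
    (Finset.sum_le_sum fun i _ => ?_)
  · have hx := (Finset.mem_filter.1 hx).2
    have hs : ∀ j, Q' (step x j) = Q (step x j) := fun j => h2 _ fun i => by
      have := hx i
      rw [step_apply]
      split_ifs <;> omega
    have hw : edgeWeight m x l = 1 := by
      have := hx l
      have := hx (l + 1)
      have := hx (l + 2)
      unfold edgeWeight
      rw [if_neg (by omega), if_neg (by omega), if_neg (by omega)]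
    rw [hs, hs, hw, one_mul]
  -- The edge parallel to the side opposite to `e^i` is compared directly; the other two directions
  -- are handled together by the path bound.
  · simp only [fun f : Fin 3 → ℕ => sum_eq_cyclic f i, add_assoc (G := ℕ)]
    rw [Finset.sum_add_distrib, Finset.sum_add_distrib (f := fun x => edgeWeight m x i * _)]
    refine Nat.add_le_add (Finset.sum_le_sum fun x hx => ?_) ?_
    · obtain ⟨hx, hi⟩ := Finset.mem_filter.1 hx
      have hxt := (mem_tri_cyclic i).1 hx
      rcases hi.lt_or_eq with hi | hi
      · rw [h1 _ (e1 ▸ step_mem_tri hx _) i, h1 _ (e1 ▸ step_mem_tri hx _) i]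
        · simp [neq]
        · rwa [step_of_ne x (add_two_ne_self i).symm]
        · rwa [step_of_ne x (add_one_ne_self i).symm]
      · have hs : ∀ j, j ≠ i → Q' (step x j) = Q (step x j) := fun j hj => h2 _ fun p => by
          rcases eq_or_ne p i with rfl | hp
          · rw [step_of_ne x hj.symm]; omega
          · have : x p ≤ m - 1 := by
              have : p = i + 1 ∨ p = i + 2 := by
                revert hp; fin_cases i <;> fin_cases p <;> decide
              rcases this with rfl | rfl <;> omega
            rw [step_apply]
            split_ifs <;> omega
        have hw : edgeWeight m x i = 1 := by
          unfold edgeWeight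
          rw [if_neg (by omega), if_neg (by omega), if_neg (by omega)]
        rw [hs _ (add_one_ne_self i), hs _ (add_two_ne_self i), hw, one_mul]
    · simp only [add_one_add_one, add_one_add_two, add_two_add_one, add_two_add_two]
      set F : ℕ → ℕ → L := fun a b => Q (cornerPoint (3 * m) i a b) with hF
      have hF0 : F 0 0 = v i := hQ i
      have hst : ∀ x ∈ tri (3 * m - 1), ∀ j, step x j ∈ tri (3 * m) := fun x hx j =>
        e1 ▸ step_mem_tri hx j
      have s0 : ∀ x ∈ tri (3 * m - 1), Q (step x i) = F (x (i + 1)) (x (i + 2)) := by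
        intro x hx
        have h := congrArg Q (eq_cornerPoint (hst x hx i) i)
        rwa [step_of_ne x (add_one_ne_self i),
          step_of_ne x (add_two_ne_self i)] at h
      have s1 : ∀ x ∈ tri (3 * m - 1), Q (step x (i + 1)) = F (x (i + 1) + 1) (x (i + 2)) := by
        intro x hx
        have h := congrArg Q (eq_cornerPoint (hst x hx (i + 1)) i)
        rwa [step_same,
          step_of_ne x (add_two_ne_add_one i)] at h
      have s2 : ∀ x ∈ tri (3 * m - 1), Q (step x (i + 2)) = F (x (i + 1)) (x (i + 2) + 1) := by
        intro x hx
        have h := congrArg Q (eq_cornerPoint (hst x hx (i + 2)) i)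
        rwa [step_same,
          step_of_ne x (add_two_ne_add_one i).symm] at h
      have hR := sum_neq_corner F m
      -- After relabelling, these two directions are cut only in the row `a + b = m - 1`, that is `x
      -- i = 2 * m`, where the edges meet the hexagon.
      have hL : ∑ a ∈ Finset.range m, (neq (F 0 0) (F (a + 1) (m - 1 - a)) +
          neq (F 0 0) (F a (m - 1 - a + 1))) = ∑ a ∈ Finset.range m, ∑ b ∈ Finset.range (m - a),
          if b = m - 1 - a then neq (F 0 0) (F (a + 1) b) + neq (F 0 0) (F a (b + 1)) else 0 := by
        refine Finset.sum_congr rfl fun a ha => ?_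
        rw [Finset.mem_range] at ha
        rw [Finset.sum_ite_eq' _ _ fun b => neq (F 0 0) (F (a + 1) b) + neq (F 0 0) (F a (b + 1)),
          if_pos (by rw [Finset.mem_range]; omega)]
      rw [hL, ← sum_filter_corner hm i _ _ fun x _ _ => rfl,
        ← sum_filter_corner hm i _ _ fun x _ _ => rfl] at hR
      refine le_trans (Finset.sum_le_sum fun x hx => ?_) (hR.trans (Finset.sum_le_sum
        fun x hx => ?_))
      · obtain ⟨hx, hi⟩ := Finset.mem_filter.1 hx
        have hxt := (mem_tri_cyclic i).1 hx
        have hv : Q' (step x i) = v i := h1 _ (e1 ▸ step_mem_tri hx _) i (by simp; omega)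
        split_ifs with hc
        · have hs : ∀ j, j ≠ i → Q' (step x j) = Q (step x j) := fun j hj => h2 _ fun p => by
            rcases eq_or_ne p i with rfl | hp
            · rw [step_of_ne x hj.symm]; omega
            · have : x p ≤ m - 1 := by
                have : p = i + 1 ∨ p = i + 2 := by
                  revert hp; fin_cases i <;> fin_cases p <;> decide
                rcases this with rfl | rfl <;> omega
              rw [step_apply]
              split_ifs <;> omega
          rw [hv, hs _ (add_one_ne_self i), hs _ (add_two_ne_self i), s1 x hx, s2 x hx, hF0,
            neq_comm _ (v i), add_comm]
        · have hs : ∀ j, Q' (step x j) = v i := fun j =>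
            h1 _ (e1 ▸ step_mem_tri hx _) i (by rw [step_apply]; omega)
          rw [hs, hs, hs]
          simp [neq]
      · obtain ⟨hx, hi⟩ := Finset.mem_filter.1 hx
        have hxt := (mem_tri_cyclic i).1 hx
        have w1 : edgeWeight m x (i + 1) = if x (i + 1) = 0 then m - x (i + 2) else 1 := by
          unfold edgeWeight
          rw [add_one_add_one, add_one_add_two, if_neg (by omega), if_neg (by omega), if_pos hi]
        have w2 : edgeWeight m x (i + 2) = if x (i + 2) = 0 then m - x (i + 1) else 1 := by
          unfold edgeWeight
          rw [add_two_add_one, add_two_add_two, if_neg (by omega), if_pos hi]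
        rw [w1, w2, s0 x hx, s1 x hx, s2 x hx, neq_comm _ (F (x (i + 1)) (x (i + 2))), add_comm]

/-- The lower bound for the weight of a cut of the triangle; `O` contains the vertices whose label
occurs on the opposite side. -/
theorem six_mul_le_sum_edgeWeight {m : ℕ} (hm : 0 < m) (Q : (Fin 3 → ℕ) → L) (v : Fin 3 → L)
    (hv : Function.Injective v) (hQ : ∀ i, Q (cornerPoint (3 * m) i 0 0) = v i)
    (O : Finset (Fin 3)) (hO : ∀ y ∈ tri (3 * m), ∀ i, y i = 0 → Q y = v i → i ∈ O) :
    6 * m ≤ (∑ x ∈ tri (3 * m - 1), ∑ l : Fin 3,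
      edgeWeight m x l * neq (Q (step x (l + 1))) (Q (step x (l + 2)))) + 2 * m * O.card := by
  classical
  set Q' : (Fin 3 → ℕ) → L := fun y => if h : ∃ i, 2 * m < y i then v h.choose else Q y with hQ'
  have h1 : ∀ y ∈ tri (3 * m), ∀ i, 2 * m < y i → Q' y = v i := by
    intro y hy i hi
    have h : ∃ i, 2 * m < y i := ⟨i, hi⟩
    have hc := h.choose_spec
    simp only [hQ', dif_pos h]
    congr 1
    -- Two coordinates above `2 * m` would exceed the sum `3 * m`, so the chosen index is unique.
    by_contra hne
    have hp : h.choose = i + 1 ∨ h.choose = i + 2 := by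
      revert hne
      generalize h.choose = p
      fin_cases i <;> fin_cases p <;> decide
    have := (mem_tri_cyclic i).1 hy
    rcases hp with hp | hp <;> rw [hp] at hc <;> omega
  have h2 : ∀ y, (∀ i, y i ≤ 2 * m) → Q' y = Q y := by
    intro y hy
    simp only [hQ']
    rw [dif_neg]
    push Not
    exact hy
  refine (six_mul_le_sum_neq hm Q' v hv h1 O fun y hy i h0 h => ?_).trans
    (Nat.add_le_add_right (sum_neq_le_sum_edgeWeight hm Q Q' v hQ h1 h2) _)
  -- Relabelling does not enlarge `O`: a relabelled point with label `v i` has `y i > 2 * m`, hence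
  -- is not on the side opposite to `e^i`.
  by_cases hb : ∃ j, 2 * m < y j
  · obtain ⟨j, hj⟩ := hb
    have := hv ((h1 y hy j hj).symm.trans h)
    subst this
    omega
  · push Not at hb
    exact hO y hy i h0 ((h2 y hb).symm.trans h)

end Corner
-- Comparison of the integer weights with the real weights.
section Weight

theorem natCast_div_le_two_thirds {m : ℕ} (hm : 0 < m) (a : ℕ) :
    (a : ℝ) / (3 * m : ℕ) ≤ 2 / 3 ↔ a ≤ 2 * m := by
  have : (0 : ℝ) < m := by exact_mod_cast hm
  rw [div_le_div_iff₀ (by push_cast; positivity) (by norm_num), ← Nat.cast_le (α := ℝ)]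
  push_cast
  constructor <;> intro h <;> linarith

theorem two_thirds_le_natCast_div {m : ℕ} (hm : 0 < m) (a : ℕ) :
    2 / 3 ≤ (a : ℝ) / (3 * m : ℕ) ↔ 2 * m ≤ a := by
  have : (0 : ℝ) < m := by exact_mod_cast hm
  rw [div_le_div_iff₀ (by norm_num) (by push_cast; positivity), ← Nat.cast_le (α := ℝ)]
  push_cast
  constructor <;> intro h <;> linarith

theorem rho_nonneg (n : ℕ) : 0 ≤ rho n := by unfold rho; positivity

theorem cornerWeight_nonneg (n : ℕ) {i : Fin 3} {x : Fin 3 → ℝ} (y : Fin 3 → ℝ)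
    (h : 2 / 3 ≤ x i) : 0 ≤ cornerWeight n i x y := by
  have hr := rho_nonneg n
  unfold cornerWeight
  split_ifs
  · refine mul_nonneg ?_ hr
    have h1 : 1 - max (x i) (y i) ≤ 1 / 3 := by
      have := le_max_left (x i) (y i)
      linarith
    have := mul_le_mul_of_nonneg_left h1 (Nat.cast_nonneg (α := ℝ) n)
    linarith
  · exact le_rfl
  · exact hr

theorem corner_term_nonneg (n : ℕ) (i : Fin 3) (x y : Fin 3 → ℝ) :
    0 ≤ if 2 / 3 ≤ x i ∧ 2 / 3 ≤ y i then cornerWeight n i x y else 0 := by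
  split_ifs with h
  · exact cornerWeight_nonneg n y h.1
  · exact le_rfl

theorem triangleWeight_nonneg (n : ℕ) (x y : Fin 3 → ℝ) : 0 ≤ triangleWeight n x y := by
  unfold triangleWeight
  split_ifs
  · exact rho_nonneg n
  · exact Finset.sum_nonneg fun i _ => corner_term_nonneg n i x y

theorem faceWeight_nonneg {k : ℕ} (n : ℕ) (a b c : Fin k) (x y : Fin k → ℝ) :
    0 ≤ faceWeight n a b c x y := by
  unfold faceWeight
  split_ifs
  · exact triangleWeight_nonneg n _ _
  · exact le_rfl

/-- The weight of an edge of direction `eᵢ - eₚ` in the corner triangle at `eᵢ`. -/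
theorem le_triangleWeight_corner {m : ℕ} (hm : 0 < m) {i p l : Fin 3} (hpi : p ≠ i) (hli : l ≠ i)
    (hpl : p ≠ l) {u w : Fin 3 → ℕ} (hi : 2 * m ≤ w i) (hui : u i = w i + 1)
    (hp : w p = u p + 1) (hl : u l = w l) (hsum : w i + u p + w l = 3 * m - 1) :
    ((if w l = 0 then m - u p else 1 : ℕ) : ℝ) * rho (3 * m) ≤
      triangleWeight (3 * m) (fun j => (u j : ℝ) / (3 * m : ℕ))
        (fun j => (w j : ℝ) / (3 * m : ℕ)) := by
  have hm' : (0 : ℝ) < m := by exact_mod_cast hm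
  have hN : (0 : ℝ) < (3 * m : ℕ) := by push_cast; positivity
  unfold triangleWeight
  refine le_of_le_of_eq ?_ (if_neg fun h => ?_).symm
  swap
  · have := (natCast_div_le_two_thirds hm _).1 (h.1 i)
    omega
  -- All terms are nonnegative and only a lower bound is needed, so the term of the corner `i`
  -- suffices.
  have hterm := Finset.single_le_sum (fun j _ => corner_term_nonneg (3 * m) j
    (fun q => (u q : ℝ) / (3 * m : ℕ)) (fun q => (w q : ℝ) / (3 * m : ℕ))) (Finset.mem_univ i)
  refine le_trans (le_of_le_of_eq ?_ (if_pos ⟨(two_thirds_le_natCast_div hm _).2 (by omega),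
    (two_thirds_le_natCast_div hm _).2 hi⟩).symm) hterm
  unfold cornerWeight
  have hz : ∀ a : ℕ, (a : ℝ) / (3 * m : ℕ) = 0 ↔ a = 0 := fun a => by
    rw [div_eq_zero_iff, Nat.cast_eq_zero]
    exact or_iff_left hN.ne'
  have hex : (∃ j, j ≠ i ∧ (u j : ℝ) / (3 * m : ℕ) = 0 ∧ (w j : ℝ) / (3 * m : ℕ) = 0) ↔
      w l = 0 := by
    simp only [hz]
    constructor
    · rintro ⟨j, hj, hj1, hj2⟩
      have : j = p ∨ j = l := by
        revert hpi hli hpl hj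
        clear * -
        revert i p l j
        decide
      rcases this with rfl | rfl
      · omega
      · exact hj2
    · exact fun h => ⟨l, hli, by omega, h⟩
  simp only [hex]
  have hmax : max ((u i : ℝ) / (3 * m : ℕ)) ((w i : ℝ) / (3 * m : ℕ)) =
      (u i : ℝ) / (3 * m : ℕ) :=
    max_eq_left (div_le_div_of_nonneg_right (by exact_mod_cast (by omega)) hN.le)
  rw [hmax]
  split_ifs with h0 h1
  · refine le_of_eq ?_
    congr 1
    -- On the side `w l = 0`, the number `n (1 - u i / n)` of edges closer to `e^i` is `u p`.
    have h : u i + u p = 3 * m := by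
      clear * - hm hui hsum h0
      omega
    have hle : u p ≤ m := by omega
    have h' : (u i : ℝ) = 3 * m - u p := by
      rw [eq_sub_iff_add_eq]
      exact_mod_cast h
    rw [Nat.cast_sub hle, mul_sub, mul_div_cancel₀ _ hN.ne', h']
    push_cast
    ring
  · rw [div_left_inj' hN.ne', Nat.cast_inj] at h1
    omega
  · simp

theorem edgeWeight_mul_rho_le {m : ℕ} (hm : 0 < m) {x : Fin 3 → ℕ} (hx : x ∈ tri (3 * m - 1))
    (l : Fin 3) :
    (edgeWeight m x l : ℝ) * rho (3 * m) ≤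
      triangleWeight (3 * m) (fun j => (step x (l + 1) j : ℝ) / (3 * m : ℕ))
        (fun j => (step x (l + 2) j : ℝ) / (3 * m : ℕ)) := by
  have hs := (mem_tri_cyclic l).1 hx
  have h1 := add_one_ne_self l
  have h2 := add_two_ne_self l
  have h3 := add_two_ne_add_one l
  unfold edgeWeight
  split_ifs with c1 c2 c3 c4 c5
  · simpa using triangleWeight_nonneg _ _ _
  · have := le_triangleWeight_corner hm h3 h1.symm h2 (u := step x (l + 1))
      (w := step x (l + 2)) (by rwa [step_of_ne x h3.symm])
      (by rw [step_of_ne x h3.symm, step_same]) (by rw [step_of_ne x h3, step_same])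
      (by rw [step_of_ne x h1.symm, step_of_ne x h2.symm])
      (by rw [step_of_ne x h3.symm, step_of_ne x h3, step_of_ne x h2.symm]; omega)
    rw [step_of_ne x h2.symm, step_of_ne x h3, if_pos c3] at this
    exact this
  · have := le_triangleWeight_corner hm h3 h1.symm h2 (u := step x (l + 1))
      (w := step x (l + 2)) (by rwa [step_of_ne x h3.symm])
      (by rw [step_of_ne x h3.symm, step_same]) (by rw [step_of_ne x h3, step_same])
      (by rw [step_of_ne x h1.symm, step_of_ne x h2.symm])
      (by rw [step_of_ne x h3.symm, step_of_ne x h3, step_of_ne x h2.symm]; omega)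
    rw [step_of_ne x h2.symm, step_of_ne x h3, if_neg c3] at this
    exact this
  · rw [triangleWeight_comm]
    have := le_triangleWeight_corner hm h3.symm h2.symm h1 (u := step x (l + 2))
      (w := step x (l + 1)) (by rwa [step_of_ne x h3])
      (by rw [step_of_ne x h3, step_same]) (by rw [step_of_ne x h3.symm, step_same])
      (by rw [step_of_ne x h1.symm, step_of_ne x h2.symm])
      (by rw [step_of_ne x h3.symm, step_of_ne x h3, step_of_ne x h1.symm]; omega)
    rw [step_of_ne x h1.symm, step_of_ne x h3.symm, if_pos c5] at this
    exact this
  · rw [triangleWeight_comm]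
    have := le_triangleWeight_corner hm h3.symm h2.symm h1 (u := step x (l + 2))
      (w := step x (l + 1)) (by rwa [step_of_ne x h3])
      (by rw [step_of_ne x h3, step_same]) (by rw [step_of_ne x h3.symm, step_same])
      (by rw [step_of_ne x h1.symm, step_of_ne x h2.symm])
      (by rw [step_of_ne x h3.symm, step_of_ne x h3, step_of_ne x h1.symm]; omega)
    rw [step_of_ne x h1.symm, step_of_ne x h3.symm, if_neg c5] at this
    exact this
  · unfold triangleWeight
    have hle : ∀ j i, step x j i ≤ 2 * m ∨ i = l ∧ j = l := by
      intro j i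
      have : i = l ∨ i = l + 1 ∨ i = l + 2 := by
        clear * -
        revert i l
        decide
      rw [step_apply]
      rcases this with rfl | rfl | rfl
      · by_cases hj : i = j
        · exact Or.inr ⟨rfl, hj.symm⟩
        · rw [if_neg hj]; omega
      · split_ifs <;> omega
      · split_ifs <;> omega
    rw [if_pos]
    · simp
    · simp only [natCast_div_le_two_thirds hm]
      exact ⟨fun i => (hle (l + 1) i).resolve_right fun h => h1 h.2,
        fun i => (hle (l + 2) i).resolve_right fun h => h2 h.2⟩

end Weight

/-! ### Embedding the lattice triangle as a face of the simplex. -/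

section Embedding

variable {k : ℕ}

/-- The point of the face spanned by `v 0, v 1, v 2` with barycentric coordinates `y / n`. -/
noncomputable def faceVec (n : ℕ) (v : Fin 3 → Fin k) (y : Fin 3 → ℕ) : Fin k → ℝ :=
  fun s => ∑ i, if v i = s then (y i : ℝ) / n else 0

theorem faceVec_apply (n : ℕ) {v : Fin 3 → Fin k} (hv : Function.Injective v) (y : Fin 3 → ℕ)
    (i : Fin 3) : faceVec n v y (v i) = (y i : ℝ) / n := by
  simp [faceVec, hv.eq_iff]

theorem faceVec_of_notMem (n : ℕ) {v : Fin 3 → Fin k} (y : Fin 3 → ℕ) {s : Fin k}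
    (hs : s ∉ Set.range v) : faceVec n v y s = 0 :=
  Finset.sum_eq_zero fun i _ => if_neg fun h => hs ⟨i, h⟩

theorem faceVec_mem_grid {n : ℕ} (hn : 0 < n) {v : Fin 3 → Fin k} (hv : Function.Injective v)
    {y : Fin 3 → ℕ} (hy : y ∈ tri n) : faceVec n v y ∈ grid k n := by
  have hn' : (n : ℝ) ≠ 0 := by exact_mod_cast hn.ne'
  refine ⟨⟨fun s => Finset.sum_nonneg fun i _ => ?_, ?_⟩, fun s => ?_⟩
  · split_ifs <;> positivity
  · rw [← Fintype.sum_of_injective v hv (fun i => (y i : ℝ) / n) _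
      (fun s hs => faceVec_of_notMem n y hs) fun i => (faceVec_apply n hv y i).symm,
      ← Finset.sum_div, ← Nat.cast_sum, Finset.Nat.mem_antidiagonalTuple.1 hy, div_self hn']
  · by_cases hs : s ∈ Set.range v
    · obtain ⟨i, rfl⟩ := hs
      exact ⟨y i, by rw [faceVec_apply n hv]; simp⟩
    · exact ⟨0, by rw [faceVec_of_notMem n y hs]; simp⟩

theorem cornerPoint_zero_mem_tri (n : ℕ) (i : Fin 3) : cornerPoint n i 0 0 ∈ tri n := by
  rw [mem_tri_cyclic i, cornerPoint_self, cornerPoint_one, cornerPoint_two]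
  rfl

/-- The map is total so that it can be composed with a cut; outside `tri n` its value is an
arbitrary vertex. -/
theorem exists_facePoint {n : ℕ} (hn : 0 < n) {v : Fin 3 → Fin k} (hv : Function.Injective v) :
    ∃ p : (Fin 3 → ℕ) → grid k n, ∀ y ∈ tri n, (p y : Fin k → ℝ) = faceVec n v y := by
  have h : ∀ y, ∃ g : grid k n, y ∈ tri n → (g : Fin k → ℝ) = faceVec n v y := by
    intro y
    by_cases hy : y ∈ tri n
    · exact ⟨⟨_, faceVec_mem_grid hn hv hy⟩, fun _ => rfl⟩
    · exact ⟨⟨_, faceVec_mem_grid hn hv (cornerPoint_zero_mem_tri n 0)⟩, fun h => absurd h hy⟩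
  choose p hp using h
  exact ⟨p, hp⟩

theorem faceVec_injective {n : ℕ} (hn : 0 < n) {v : Fin 3 → Fin k} (hv : Function.Injective v) :
    Function.Injective (faceVec n v) := by
  intro y z h
  funext i
  have hn' : (n : ℝ) ≠ 0 := by exact_mod_cast hn.ne'
  have := congrFun h (v i)
  rw [faceVec_apply n hv, faceVec_apply n hv, div_left_inj' hn', Nat.cast_inj] at this
  exact this

theorem faceVec_cornerPoint {n : ℕ} (hn : 0 < n) {v : Fin 3 → Fin k} (hv : Function.Injective v)
    (i : Fin 3) : faceVec n v (cornerPoint n i 0 0) = Pi.single (v i) 1 := by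
  have hn' : (n : ℝ) ≠ 0 := by exact_mod_cast hn.ne'
  funext s
  by_cases hs : s ∈ Set.range v
  · obtain ⟨j, rfl⟩ := hs
    rw [faceVec_apply n hv, Pi.single_apply]
    simp only [hv.eq_iff]
    by_cases hj : j = i
    · subst hj; simp [hn']
    · simp [cornerPoint, hj]
  · rw [faceVec_of_notMem n _ hs, Pi.single_apply, if_neg]
    rintro rfl
    exact hs ⟨i, rfl⟩

theorem sum_abs_faceVec_step {n : ℕ} {v : Fin 3 → Fin k} (hv : Function.Injective v)
    (x : Fin 3 → ℕ) (l : Fin 3) :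
    ∑ s, |faceVec n v (step x (l + 1)) s - faceVec n v (step x (l + 2)) s| = 2 / n := by
  rw [← Fintype.sum_of_injective v hv
    (fun i => |(step x (l + 1) i : ℝ) / n - (step x (l + 2) i : ℝ) / n|) _
    (fun s hs => by rw [faceVec_of_notMem n _ hs, faceVec_of_notMem n _ hs]; simp)
    fun i => by rw [faceVec_apply n hv, faceVec_apply n hv], sum_eq_cyclic _ l]
  have h1 := add_one_ne_self l
  have h2 := add_two_ne_self l
  have h3 := add_two_ne_add_one l
  rw [step_of_ne x h1.symm, step_of_ne x h2.symm, step_of_ne x h3, step_of_ne x h3.symm,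
    step_same, step_same]
  have e1 : ((x (l + 1) + 1 : ℕ) : ℝ) / n - (x (l + 1) : ℝ) / n = 1 / n := by push_cast; ring
  have e2 : (x (l + 2) : ℝ) / n - ((x (l + 2) + 1 : ℕ) : ℝ) / n = -(1 / n) := by push_cast; ring
  rw [e1, e2, sub_self, abs_zero, abs_neg, abs_of_nonneg (by positivity)]
  ring

theorem step_ne_step (x : Fin 3 → ℕ) {i j : Fin 3} (h : i ≠ j) : step x i ≠ step x j := by
  intro he
  have := congrFun he i
  rw [step_same, step_of_ne x h] at this
  omega

/-- An edge determines the up-triangle it belongs to and its direction. -/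
theorem step_pair_injective {x y : Fin 3 → ℕ} {l q : Fin 3}
    (h : (step x (l + 1) = step y (q + 1) ∧ step x (l + 2) = step y (q + 2)) ∨
      (step x (l + 1) = step y (q + 2) ∧ step x (l + 2) = step y (q + 1))) :
    x = y ∧ l = q := by
  have h1 : ∀ j, x j + (if j = l + 1 then 1 else 0) = y j + (if j = q + 1 then 1 else 0) ∧
      x j + (if j = l + 2 then 1 else 0) = y j + (if j = q + 2 then 1 else 0) ∨
      x j + (if j = l + 1 then 1 else 0) = y j + (if j = q + 2 then 1 else 0) ∧
      x j + (if j = l + 2 then 1 else 0) = y j + (if j = q + 1 then 1 else 0) := by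
    intro j
    simp only [← step_apply]
    rcases h with ⟨h, h'⟩ | ⟨h, h'⟩
    · exact Or.inl ⟨congrFun h j, congrFun h' j⟩
    · exact Or.inr ⟨congrFun h j, congrFun h' j⟩
  -- The coordinatewise minimum of the two end points recovers the base point; `l` is then the only
  -- coordinate that neither end point raises.
  have hxy : x = y := by
    funext j
    have := h1 j
    have a1 : ¬ (j = l + 1 ∧ j = l + 2) := fun h => add_two_ne_add_one l (h.2.symm.trans h.1)
    have a2 : ¬ (j = q + 1 ∧ j = q + 2) := fun h => add_two_ne_add_one q (h.2.symm.trans h.1)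
    split_ifs at this <;> omega
  refine ⟨hxy, ?_⟩
  subst hxy
  by_contra hne
  have h2 := h1 l
  rw [if_neg (add_one_ne_self l).symm, if_neg (add_two_ne_self l).symm] at h2
  have : l = q + 1 ∨ l = q + 2 := by
    clear * - hne
    revert l q
    decide
  rcases this with h | h <;> rw [if_pos h] at h2 <;> omega

open scoped Classical in
/-- The cost of a cut with respect to the weights of one face. -/
theorem one_sub_le_sum_faceWeight {n m : ℕ} (hm : 0 < m) (hnm : n = 3 * m)
    (P : grid k n → Fin k) (hP : IsKWayCut P) (w : Sym2 (grid k n) → ℝ) (a b c : Fin k)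
    (hw : ∀ x y : grid k n, w s(x, y) = faceWeight n a b c x y)
    (hv : Function.Injective ![a, b, c]) :
    1 - ((if c ∈ lineClusters P a b then 1 else 0) + (if b ∈ lineClusters P a c then 1 else 0) +
      (if a ∈ lineClusters P b c then 1 else 0)) / 3 ≤ cost P w := by
  have hn : 0 < n := by omega
  set v : Fin 3 → Fin k := ![a, b, c] with hvdef
  obtain ⟨p, hp⟩ := exists_facePoint hn hv
  have e1 : 3 * m - 1 + 1 = n := by omega
  have hst : ∀ x ∈ tri (3 * m - 1), ∀ j, step x j ∈ tri n := fun x hx j => e1 ▸ step_mem_tri hx j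
  have hrange : ∀ y ∈ tri n, Function.support (p y : Fin k → ℝ) ⊆ {a, b, c} := by
    intro y hy s hs
    rw [hp y hy] at hs
    by_contra hc
    refine hs (faceVec_of_notMem n y ?_)
    rintro ⟨i, rfl⟩
    apply hc
    rw [hvdef]
    fin_cases i <;> simp
  have hface : ∀ y ∈ tri n, ![(p y : Fin k → ℝ) a, (p y : Fin k → ℝ) b, (p y : Fin k → ℝ) c] =
      fun i => (y i : ℝ) / n := by
    intro y hy
    rw [hp y hy]
    funext i
    rw [← faceVec_apply n hv y i]
    fin_cases i <;> rfl
  have hQ : ∀ i, P (p (cornerPoint (3 * m) i 0 0)) = v i := by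
    intro i
    rw [← hnm]
    refine hP _ _ ?_
    rw [hp _ (cornerPoint_zero_mem_tri n i), faceVec_cornerPoint hn hv]
  have hsupp : ∀ y ∈ tri n, ∀ i, y i = 0 →
      Function.support (p y : Fin k → ℝ) ⊆ {v (i + 1), v (i + 2)} := by
    intro y hy i hi s hs
    rw [hp y hy] at hs
    by_cases hr : s ∈ Set.range v
    · obtain ⟨j, rfl⟩ := hr
      have : j = i ∨ j = i + 1 ∨ j = i + 2 := by
        clear * -
        revert i j
        decide
      rcases this with rfl | rfl | rfl
      · refine absurd ?_ hs
        rw [faceVec_apply n hv, hi]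
        simp
      · simp
      · simp
    · exact absurd (faceVec_of_notMem n y hr) hs
  set O : Finset (Fin 3) :=
    Finset.univ.filter fun i => v i ∈ lineClusters P (v (i + 1)) (v (i + 2)) with hOdef
  have hO : ∀ y ∈ tri (3 * m), ∀ i, y i = 0 → P (p y) = v i → i ∈ O := by
    intro y hy i hi h
    rw [hOdef, Finset.mem_filter]
    exact ⟨Finset.mem_univ _, p y, hsupp y (hnm ▸ hy) i hi, h⟩
  have hmain := six_mul_le_sum_edgeWeight hm (fun y => P (p y)) v hv hQ O hO
  have hOc : (O.card : ℝ) = (if c ∈ lineClusters P a b then 1 else 0) +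
      (if b ∈ lineClusters P a c then 1 else 0) + (if a ∈ lineClusters P b c then 1 else 0) := by
    rw [hOdef, Finset.card_filter, Fin.sum_univ_three]
    have hsymm : lineClusters P c a = lineClusters P a c := by
      simp only [lineClusters, Set.pair_comm]
    change (((if a ∈ lineClusters P b c then 1 else 0) + (if b ∈ lineClusters P c a then 1 else 0) +
      (if c ∈ lineClusters P a b then 1 else 0) : ℕ) : ℝ) = _
    rw [hsymm]
    push_cast
    ring
  rw [← hOc]
  have hwn : ∀ e, 0 ≤ w e := by
    intro e
    induction e with
    | h x y => rw [hw]; exact faceWeight_nonneg _ _ _ _ _ _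
  set φ : (Fin 3 → ℕ) × Fin 3 → Sym2 (grid k n) :=
    fun q => s(p (step q.1 (q.2 + 1)), p (step q.1 (q.2 + 2))) with hφ
  have hpinj : ∀ y ∈ tri n, ∀ z ∈ tri n, p y = p z → y = z := by
    intro y hy z hz h
    apply faceVec_injective hn hv
    rw [← hp y hy, ← hp z hz, h]
  -- The edges of the upward triangles inject into the edges of the grid; all other edges have
  -- nonnegative weight and are dropped.
  have hcost : ∑ q ∈ tri (3 * m - 1) ×ˢ (Finset.univ : Finset (Fin 3)),
      w (φ q) * (if ((φ q).map P).IsDiag then 0 else 1) ≤ cost P w := by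
    unfold cost
    rw [← Finset.sum_image (f := fun e : Sym2 (grid k n) => w e * (if (e.map P).IsDiag then 0 else 1))
      (g := φ)]
    · refine Finset.sum_le_sum_of_subset_of_nonneg (fun e he => ?_) fun e _ _ =>
        mul_nonneg (hwn e) (by split_ifs <;> simp)
      obtain ⟨q, hq, rfl⟩ := Finset.mem_image.1 he
      have hx := (Finset.mem_product.1 hq).1
      rw [SimpleGraph.mem_edgeFinset, hφ, SimpleGraph.mem_edgeSet]
      refine ⟨fun h => ?_, ?_⟩
      · exact step_ne_step q.1 (add_two_ne_add_one q.2).symm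
          (hpinj _ (hst _ hx _) _ (hst _ hx _) h)
      · rw [hp _ (hst _ hx _), hp _ (hst _ hx _)]
        exact sum_abs_faceVec_step hv _ _
    · rintro ⟨x, l⟩ hq ⟨y, r⟩ hr h
      have hx := (Finset.mem_product.1 hq).1
      have hy := (Finset.mem_product.1 hr).1
      have := step_pair_injective ((Sym2.eq_iff.1 h).imp
        (fun h => ⟨hpinj _ (hst _ hx _) _ (hst _ hy _) h.1,
          hpinj _ (hst _ hx _) _ (hst _ hy _) h.2⟩)
        fun h => ⟨hpinj _ (hst _ hx _) _ (hst _ hy _) h.1,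
          hpinj _ (hst _ hx _) _ (hst _ hy _) h.2⟩)
      exact Prod.ext this.1 this.2
  refine le_trans ?_ hcost
  have hterm : ∀ q ∈ tri (3 * m - 1) ×ˢ (Finset.univ : Finset (Fin 3)),
      rho n * ((edgeWeight m q.1 q.2 * neq (P (p (step q.1 (q.2 + 1))))
        (P (p (step q.1 (q.2 + 2)))) : ℕ) : ℝ) ≤
      w (φ q) * (if ((φ q).map P).IsDiag then 0 else 1) := by
    rintro ⟨x, l⟩ hq
    have hx := (Finset.mem_product.1 hq).1
    have h1 := hst x hx (l + 1)
    have h2 := hst x hx (l + 2)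
    have hwe := edgeWeight_mul_rho_le hm hx l
    rw [← hnm] at hwe
    have hwq : w (φ (x, l)) = triangleWeight n (fun j => (step x (l + 1) j : ℝ) / n)
        (fun j => (step x (l + 2) j : ℝ) / n) := by
      rw [hφ, hw, faceWeight, if_pos ⟨hrange _ h1, hrange _ h2⟩, hface _ h1, hface _ h2]
    rw [hwq]
    simp only [hφ, Sym2.map_mk, Sym2.mk_isDiag_iff, neq]
    split_ifs
    · simp
    · simpa [mul_comm] using hwe
  refine le_trans ?_ (Finset.sum_le_sum hterm)
  rw [← Finset.mul_sum, ← Nat.cast_sum, Finset.sum_product]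
  have hm' : (0 : ℝ) < m := by exact_mod_cast hm
  have hreal : (6 * m : ℝ) ≤ ((∑ x ∈ tri (3 * m - 1), ∑ l : Fin 3, edgeWeight m x l *
      neq (P (p (step x (l + 1)))) (P (p (step x (l + 2)))) : ℕ) : ℝ) + 2 * m * O.card := by
    exact_mod_cast hmain
  rw [rho, hnm, one_div_mul_eq_div, le_div_iff₀ (by push_cast; positivity)]
  push_cast at hreal ⊢
  nlinarith

end Embedding
-- Averaging over the three-element faces.
section Averaging

variable {k : ℕ}

/-- Splitting the pairs `i < j` with a third element according to the place of that element. -/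
theorem sum_pairs_third (g : Fin k → Fin k → Fin k → ℝ) :
    ∑ p : Fin k × Fin k with p.1 < p.2, ∑ l, (if l ≠ p.1 ∧ l ≠ p.2 then g p.1 p.2 l else 0) =
      ∑ t : Fin k × Fin k × Fin k with t.1 < t.2.1 ∧ t.2.1 < t.2.2,
        (g t.1 t.2.1 t.2.2 + g t.1 t.2.2 t.2.1 + g t.2.1 t.2.2 t.1) := by
  -- The third element comes after `j`, between `i` and `j`, or before `i`.
  have h : ∀ i j l : Fin k, (if i < j then (if l ≠ i ∧ l ≠ j then g i j l else 0) else 0) =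
      (if i < j ∧ j < l then g i j l else 0) + (if i < l ∧ l < j then g i j l else 0) +
        (if l < i ∧ i < j then g i j l else 0) := by
    intro i j l
    split_ifs <;> first | (exfalso; omega) | simp
  have hl : ∑ p : Fin k × Fin k with p.1 < p.2,
      ∑ l, (if l ≠ p.1 ∧ l ≠ p.2 then g p.1 p.2 l else 0) =
      ∑ i, ∑ j, ∑ l, (if i < j then (if l ≠ i ∧ l ≠ j then g i j l else 0) else 0) := by
    rw [Finset.sum_filter, Fintype.sum_prod_type]
    refine Finset.sum_congr rfl fun i _ => Finset.sum_congr rfl fun j _ => ?_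
    dsimp only
    split_ifs <;> simp
  rw [hl, Finset.sum_filter, Fintype.sum_prod_type]
  simp only [Fintype.sum_prod_type, h, Finset.sum_add_distrib, ite_add_zero]
  have hA : ∀ f : Fin k → Fin k → Fin k → ℝ, ∑ i, ∑ j, ∑ l, f i j l = ∑ i, ∑ l, ∑ j, f i j l :=
    fun f => Finset.sum_congr rfl fun i _ => Finset.sum_comm
  rw [hA fun i j l => if i < l ∧ l < j then g i j l else 0,
    hA fun i j l => if l < i ∧ i < j then g i j l else 0]
  congr 1
  exact Finset.sum_comm

theorem card_pairs (k : ℕ) :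
    (Finset.univ.filter fun p : Fin k × Fin k => p.1 < p.2).card = k.choose 2 := by
  have h : ∀ i j : Fin k, 1 = (if i < j then 1 else 0) + (if j < i then 1 else 0) +
      if i = j then 1 else 0 := by
    intro i j
    split_ifs <;> omega
  have hsum : ∑ i : Fin k, ∑ j : Fin k, 1 = ∑ i : Fin k, ∑ j : Fin k,
      ((if i < j then 1 else 0) + (if j < i then 1 else 0) + if i = j then 1 else 0) :=
    Finset.sum_congr rfl fun i _ => Finset.sum_congr rfl fun j _ => h i j
  simp only [Finset.sum_add_distrib] at hsum
  rw [Finset.sum_comm (f := fun i j : Fin k => if j < i then 1 else 0)] at hsum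
  rw [Finset.card_filter, Fintype.sum_prod_type]
  have hc := Nat.choose_succ_right_eq k 1
  rw [Nat.choose_one_right, Nat.mul_sub, mul_one] at hc
  simp only [Finset.sum_ite_eq, Finset.mem_univ, if_true, Finset.sum_const, Finset.card_univ,
    Fintype.card_fin, smul_eq_mul, mul_one] at hsum
  have hk := Nat.le_mul_self k
  dsimp only
  norm_num at hc
  generalize k * k = q at hc hk hsum
  omega

/-- Double counting: `sum_pairs_third` with the constant `1` counts each triple three times and each
pair `k - 2` times. -/
theorem card_triples (k : ℕ) :
    (Finset.univ.filter fun t : Fin k × Fin k × Fin k => t.1 < t.2.1 ∧ t.2.1 < t.2.2).card =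
      k.choose 3 := by
  have h := sum_pairs_third (k := k) fun _ _ _ => 1
  have h1 : ∀ p ∈ Finset.univ.filter fun p : Fin k × Fin k => p.1 < p.2,
      ∑ l : Fin k, (if l ≠ p.1 ∧ l ≠ p.2 then (1 : ℝ) else 0) = (k - 2 : ℕ) := by
    intro p hp
    have hp : p.1 < p.2 := (Finset.mem_filter.1 hp).2
    have he : (Finset.univ.filter fun l : Fin k => l ≠ p.1 ∧ l ≠ p.2) =
        (({p.1, p.2} : Finset (Fin k))ᶜ) := by
      ext l
      simp
    rw [Finset.sum_boole, he, Finset.card_compl, Finset.card_pair hp.ne, Fintype.card_fin]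
  rw [Finset.sum_congr rfl h1, Finset.sum_const, Finset.sum_const, card_pairs] at h
  have h3 := Nat.choose_succ_right_eq k 2
  have h4 : k.choose 2 * (k - 2) = (Finset.univ.filter fun t : Fin k × Fin k × Fin k =>
      t.1 < t.2.1 ∧ t.2.1 < t.2.2).card * 3 := by
    have : ((k.choose 2 * (k - 2) : ℕ) : ℝ) = ((Finset.univ.filter fun t : Fin k × Fin k × Fin k =>
      t.1 < t.2.1 ∧ t.2.1 < t.2.2).card * 3 : ℕ) := by
      rw [nsmul_eq_mul, nsmul_eq_mul] at h
      push_cast at h ⊢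
      linarith
    exact_mod_cast this
  norm_num at h3
  omega

theorem mem_lineClusters_left {n : ℕ} (hn : 0 < n) {P : grid k n → Fin k} (hP : IsKWayCut P)
    (i j : Fin k) : i ∈ lineClusters P i j := by
  have hn' : (n : ℝ) ≠ 0 := by exact_mod_cast hn.ne'
  have h : (Pi.single i 1 : Fin k → ℝ) ∈ grid k n := by
    refine ⟨single_mem_stdSimplex ℝ i, fun s => ?_⟩
    by_cases hs : s = i
    · subst hs
      exact ⟨n, by simp [hn']⟩
    · exact ⟨0, by simp [hs]⟩
  refine ⟨⟨_, h⟩, ?_, hP i _ rfl⟩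
  exact Pi.support_single_subset.trans (by simp)

theorem mem_lineClusters_right {n : ℕ} (hn : 0 < n) {P : grid k n → Fin k} (hP : IsKWayCut P)
    (i j : Fin k) : j ∈ lineClusters P i j := by
  have h := mem_lineClusters_left hn hP j i
  simpa only [lineClusters, Set.pair_comm] using h

open scoped Classical in
-- The subtracted `2` accounts for the end points, whose labels always occur on their line; this is
-- where `D(P) - 2` comes from.
theorem sum_third_mem_eq_ncard_sub_two (D : Set (Fin k)) {i j : Fin k} (hij : i ≠ j) (hi : i ∈ D)
    (hj : j ∈ D) :
    ∑ l, (if l ≠ i ∧ l ≠ j then (if l ∈ D then (1 : ℝ) else 0) else 0) = D.ncard - 2 := by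
  have h : ∀ l, (if l ≠ i ∧ l ≠ j then (if l ∈ D then (1 : ℝ) else 0) else 0) =
      (if l ∈ D then 1 else 0) - (if l = i then 1 else 0) - (if l = j then 1 else 0) := by
    intro l
    by_cases h1 : l = i
    · subst h1; simp [hi, hij]
    · by_cases h2 : l = j
      · subst h2; simp [hj, h1]
      · simp [h1, h2]
  simp only [h, Finset.sum_sub_distrib]
  rw [Finset.sum_boole, Set.ncard_eq_toFinset_card']
  simp
  ring

theorem cost_avgWeight {n : ℕ} (P : grid k n → Fin k)
    (w : Fin k × Fin k × Fin k → Sym2 (grid k n) → ℝ)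
    (hw : ∀ t, ∀ x y : grid k n, w t s(x, y) = faceWeight n t.1 t.2.1 t.2.2 x y) :
    cost P (avgWeight k n) =
      (∑ t : Fin k × Fin k × Fin k with t.1 < t.2.1 ∧ t.2.1 < t.2.2, cost P (w t)) /
        (k.choose 3 : ℝ) := by
  unfold cost
  rw [Finset.sum_comm, Finset.sum_div]
  refine Finset.sum_congr rfl fun e _ => ?_
  rw [← Finset.sum_mul, mul_div_right_comm]
  congr 1
  induction e with
  | h x y =>
    simp only [hw]
    rfl

end Averaging
end MultiwayCut

theorem mainTheorem7 (k n : ℕ) (hk : 3 ≤ k) (hn : 0 < n) (h3 : 3 ∣ n)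
    (P : MultiwayCut.grid k n → Fin k) (hP : MultiwayCut.IsKWayCut P) :
    1 - (MultiwayCut.avgClusters P - 2) / ((k : ℝ) - 2) ≤
      MultiwayCut.cost P (MultiwayCut.avgWeight k n) := by
  classical
  obtain ⟨m, rfl⟩ := h3
  set T := Finset.univ.filter fun t : Fin k × Fin k × Fin k => t.1 < t.2.1 ∧ t.2.1 < t.2.2
    with hT
  set w : Fin k × Fin k × Fin k → Sym2 (MultiwayCut.grid k (3 * m)) → ℝ := fun t =>
    Sym2.lift ⟨fun x y => MultiwayCut.faceWeight (3 * m) t.1 t.2.1 t.2.2 x y,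
      fun x y => MultiwayCut.faceWeight_comm _ _ _ _ _ _⟩
  rw [MultiwayCut.cost_avgWeight P w fun _ _ _ => rfl, ← hT]
  have hcost : ∀ t ∈ T, 1 - ((if t.2.2 ∈ MultiwayCut.lineClusters P t.1 t.2.1 then (1 : ℝ) else 0) +
      (if t.2.1 ∈ MultiwayCut.lineClusters P t.1 t.2.2 then 1 else 0) +
      (if t.1 ∈ MultiwayCut.lineClusters P t.2.1 t.2.2 then 1 else 0)) / 3 ≤
      MultiwayCut.cost P (w t) := by
    rintro ⟨a, b, c⟩ ht
    obtain ⟨hab, hbc⟩ : a < b ∧ b < c := (Finset.mem_filter.1 ht).2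
    refine MultiwayCut.one_sub_le_sum_faceWeight (by omega) rfl P hP (w (a, b, c)) a b c
      (fun _ _ => rfl) ?_
    intro i j hij
    fin_cases i <;> fin_cases j <;> simp at hij ⊢ <;> omega
  have hsum := Finset.sum_le_sum hcost
  -- The losses of all faces are regrouped by the line on which the foreign label occurs.
  rw [Finset.sum_sub_distrib, ← Finset.sum_div,
    ← MultiwayCut.sum_pairs_third fun i j l => if l ∈ MultiwayCut.lineClusters P i j then 1 else 0,
    Finset.sum_const, MultiwayCut.card_triples k,
    Finset.sum_congr rfl fun p hp => MultiwayCut.sum_third_mem_eq_ncard_sub_two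
      (MultiwayCut.lineClusters P p.1 p.2) (Finset.mem_filter.1 hp).2.ne
      (MultiwayCut.mem_lineClusters_left hn hP _ _) (MultiwayCut.mem_lineClusters_right hn hP _ _),
    Finset.sum_sub_distrib, Finset.sum_const, MultiwayCut.card_pairs] at hsum
  have hC2 : (0 : ℝ) < k.choose 2 := by exact_mod_cast Nat.choose_pos (by omega)
  have hC3 : (0 : ℝ) < k.choose 3 := by exact_mod_cast Nat.choose_pos hk
  have hk2 : (0 : ℝ) < (k : ℝ) - 2 := by
    have : (3 : ℝ) ≤ k := by exact_mod_cast hk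
    linarith
  have hch : (k.choose 3 : ℝ) * 3 = k.choose 2 * ((k : ℝ) - 2) := by
    have h := Nat.choose_succ_right_eq k 2
    have h' : ((k.choose (2 + 1) * (2 + 1) : ℕ) : ℝ) = (k.choose 2 * (k - 2) : ℕ) := by
      exact_mod_cast h
    rw [Nat.cast_mul, Nat.cast_mul, Nat.cast_sub (by omega)] at h'
    norm_num at h'
    exact h'
  refine le_trans (le_of_eq ?_) (div_le_div_of_nonneg_right hsum hC3.le)
  unfold MultiwayCut.avgClusters
  simp only [nsmul_eq_mul]
  generalize (∑ p : Fin k × Fin k with p.1 < p.2,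
    ((MultiwayCut.lineClusters P p.1 p.2).ncard : ℝ)) = S
  have hk3 : (k : ℝ) - 2 = k.choose 3 * 3 / k.choose 2 := by
    rw [hch]; field_simp
  rw [hk3]
  field_simp
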